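/- Lemma 1.2 (lem:E_is_negative_and_SD). Assume either (i) $N=2$, $\alpha\in\mathbb{R}$ and $p>2$, or (ii) $N=3$, $\alpha<0$ and $2<p<3$. All functions are complex-valued functions on $\mathbb{R}^N$, and $\langle f,g\rangle_{L^2}=\int f\,\overline{g}\,\mathrm{d}x$. For $\lambda>0$ let $$G_\lambda(x)=\frac{1}{2\pi}K_0(\sqrt{\lambda}\,|x|)\ \text{ if } N=2,\qquad G_\lambda(x)=\frac{e^{-\sqrt{\lambda}|x|}}{4\pi|x|}\ \text{ if } N=3,$$ where $K_0(r)=\int_0^\infty e^{-r\cosh t}\,\mathrm{d}t$ is the modified Bessel function of the second kind, and let $$\beta_\alpha(\lambda)=\alpha+\frac{\log\sqrt{\lambda}+\gamma-\log 2}{2\pi}\ \text{ if } N=2,\qquad \beta_\alpha(\lambda)=\alpha+\frac{\sqrt{\lambda}}{4\pi}\ \text{ if } N=3,$$ where $\gamma$ is the Euler--Mascheroni constant. Let $$H^1_\alpha=\{\phi+qG_\lambda:\ \phi\in H^1(\mathbb{R}^N),\ q\in\mathbb{C},\ \lambda>0\},$$ and for $u_j=\phi_j+q_jG_\lambda\in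 H^1_\alpha$ ($j=1,2$, with a common $\lambda>0$) let $$h_\alpha(u_1,u_2)=\int\nabla\phi_1\cdot\overline{\nabla\phi_2}\,\mathrm{d}x+\lambda\bigl(\langle\phi_1,\phi_2\rangle_{L^2}-\langle u_1,u_2\rangle_{L^2}\bigr)+\beta_\alpha(\lambda)\,q_1\overline{q_2},$$ a quantity that does not depend on the choice of $\lambda>0$. For $u\in H^1_\alpha$ let $$\mathcal{E}(u)=\frac12h_\alpha(u,u)+\frac1p\|u\|_{L^p}^p,$$ and for $\mu>0$ let $$E(\mu)=\inf\{\mathcal{E}(v):\ v\in H^1_\alpha,\ \|v\|_{L^2}^2=\mu\}.$$ Then there is $\mu_0=\mu_0(N,\alpha,p)>0$ such that $E(\mu)<0$ for every $\mu\in\,]0,\mu_0[$ and $E$ is strictly decreasing on $]0,\mu_0[$. -/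

import Mathlib

open MeasureTheory
open scoped SchwartzMap LineDeriv

noncomputable section

namespace PointNLS

/-- Euclidean space of dimension `N`. -/
abbrev Space (N : ℕ) := EuclideanSpace ℝ (Fin N)

/-- The complex Hilbert space `L²` of (classes of) functions on `ℝ^N`.
Mathlib's inner product `inner ℂ f g = ∫ conj f * g` is conjugate-linear in its first argument. -/
abbrev L2 (N : ℕ) := Lp ℂ 2 (volume : Measure (Space N))

/-- Membership in the Sobolev space `H¹`. -/
def MemH1 {N : ℕ} (φ : L2 N) : Prop :=
  TemperedDistribution.MemSobolev 1 2 (φ : 𝓢'(Space N, ℂ))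

/-- `g` is the `i`-th weak partial derivative of `φ`: the distributional derivative of `φ` in
the `i`-th coordinate direction is the `L²` function `g`. -/
def IsWeakPartial {N : ℕ} (i : Fin N) (φ g : L2 N) : Prop :=
  ∂_{(EuclideanSpace.single i (1 : ℝ) : Space N)} (φ : 𝓢'(Space N, ℂ)) = (g : 𝓢'(Space N, ℂ))

theorem MemH1.exists_weakPartial {N : ℕ} {φ : L2 N} (hφ : MemH1 φ) (i : Fin N) :
    ∃ g : L2 N, IsWeakPartial i φ g := by
  have h := TemperedDistribution.MemSobolev.lineDerivOp
    (m := (EuclideanSpace.single i (1 : ℝ) : Space N)) hφ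
  rw [sub_self] at h
  exact TemperedDistribution.memSobolev_zero_iff.mp h

theorem IsWeakPartial.unique {N : ℕ} {i : Fin N} {φ g g' : L2 N} (h : IsWeakPartial i φ g)
    (h' : IsWeakPartial i φ g') : g = g' := by
  have hk := Lp.ker_toTemperedDistributionCLM_eq_bot
    (F := ℂ) (μ := (volume : Measure (Space N))) (p := 2)
  rw [LinearMap.ker_eq_bot] at hk
  exact hk (h.symm.trans h')

open Classical in
/-- The `i`-th weak partial derivative of `φ` (it exists and is unique for `φ ∈ H¹`). -/
def weakPartial {N : ℕ} (i : Fin N) (φ : L2 N) : L2 N :=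
  if h : ∃ g : L2 N, IsWeakPartial i φ g then h.choose else 0

/-- The modified Bessel function of the second kind `K₀`, for `r > 0`, by its classical
integral representation. -/
def besselK0 (r : ℝ) : ℝ := ∫ t in Set.Ioi (0 : ℝ), Real.exp (-(r * Real.cosh t))

/-- The Green function `G_λ` of `-Δ + λ` on `ℝ^N`, for `N = 2` and `N = 3`
(the value at the origin is irrelevant; other dimensions are not used). -/
def green (N : ℕ) (lam : ℝ) (x : Space N) : ℝ :=
  if N = 2 then 1 / (2 * Real.pi) * besselK0 (Real.sqrt lam * ‖x‖)
  else if N = 3 then Real.exp (-(Real.sqrt lam * ‖x‖)) / (4 * Real.pi * ‖x‖)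
  else 0

/-- The coefficient `β_α(λ)`, for `N = 2` and `N = 3` (other dimensions are not used). -/
def betaCoeff (N : ℕ) (α lam : ℝ) : ℝ :=
  if N = 2 then
    α + (Real.log (Real.sqrt lam) + Real.eulerMascheroniConstant - Real.log 2) / (2 * Real.pi)
  else if N = 3 then α + Real.sqrt lam / (4 * Real.pi)
  else 0

/-- `u = φ + q G_λ` almost everywhere, with `φ ∈ H¹`. -/
def IsDecomp {N : ℕ} (lam : ℝ) (u φ : L2 N) (q : ℂ) : Prop :=
  MemH1 φ ∧ ∀ᵐ x : Space N, u x = φ x + q * (green N lam x : ℂ)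

/-- Membership in the energy space `H¹_α = {φ + q G_λ : φ ∈ H¹, q ∈ ℂ, λ > 0}`
(as a set, it does not depend on `α`). -/
def MemEnergySpace {N : ℕ} (u : L2 N) : Prop :=
  ∃ (lam : ℝ) (φ : L2 N) (q : ℂ), 0 < lam ∧ IsDecomp lam u φ q

/-- `z` is the value of the sesquilinear form `h_α(u₁, u₂)` computed through some
`λ > 0` and decompositions `u₁ = φ₁ + q₁ G_λ`, `u₂ = φ₂ + q₂ G_λ`:
`z = ∫ ∇φ₁ · conj ∇φ₂ + λ (⟨φ₁, φ₂⟩ - ⟨u₁, u₂⟩) + β_α(λ) q₁ conj q₂`,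
where `⟨f, g⟩ = ∫ f conj g`. -/
def IsFormValue {N : ℕ} (α : ℝ) (u₁ u₂ : L2 N) (z : ℂ) : Prop :=
  ∃ (lam : ℝ) (φ₁ φ₂ : L2 N) (q₁ q₂ : ℂ),
    0 < lam ∧ IsDecomp lam u₁ φ₁ q₁ ∧ IsDecomp lam u₂ φ₂ q₂ ∧
    z = ∑ i : Fin N, inner ℂ (weakPartial i φ₂) (weakPartial i φ₁)
      + (lam : ℂ) * (inner ℂ φ₂ φ₁ - inner ℂ u₂ u₁)
      + (betaCoeff N α lam : ℂ) * (q₁ * (starRingEnd ℂ) q₂)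

open Classical in
/-- The sesquilinear form `h_α` on the energy space. Every `λ > 0` admits a unique decomposition
and all of them give the same value, which is the one chosen here; `0` outside the energy space. -/
def pointForm {N : ℕ} (α : ℝ) (u₁ u₂ : L2 N) : ℂ :=
  if h : ∃ z : ℂ, IsFormValue α u₁ u₂ z then h.choose else 0

/-- The energy `ℰ(u) = ½ h_α(u, u) + (1/p) ‖u‖_{L^p}^p` of `u` in the energy space
(`h_α(u, u)` is a real number). -/
def energy {N : ℕ} (α p : ℝ) (u : L2 N) : ℝ :=
  1 / 2 * (pointForm α u u).re + 1 / p * ∫ x : Space N, ‖u x‖ ^ p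

/-- The sphere `𝒮(μ)` of elements `v` of the energy space with mass `‖v‖_{L²}² = μ`. -/
def massSphere (N : ℕ) (μ : ℝ) : Set (L2 N) :=
  {v | MemEnergySpace v ∧ ‖v‖ ^ 2 = μ}

/-- The ground state energy `E(μ) = inf {ℰ(v) : v ∈ 𝒮(μ)}`. A negative value is a genuine
infimum, since the infimum of an empty or unbounded-below set of reals is `0` in Mathlib. -/
def groundEnergy (N : ℕ) (α p μ : ℝ) : ℝ :=
  sInf (energy α p '' massSphere N μ)

end PointNLS

end

/-!
# Small masses: the ground state energy is negative and strictly decreasing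

By Plancherel, everything about the form `h_α` is read off on the Fourier side. The Green function
`G_λ` is the Laplace transform in time of the heat kernel (`integral_heatWeight_eq_green`), so its
Fourier transform is the symbol `(λ + 4π²|ξ|²)⁻¹` (`fourier_green`, `exists_greenL2`). This symbol
is square integrable for `N ≤ 3`, but `|ξ|` times it is not for `N ≥ 2`, so the charge `q` of
`u = φ + q G_λ` is unique, even across different `λ` (`charge_eq_of_memLp`). The density
`(4π²|ξ|² + λ) |𝓕φ|² - λ |𝓕u|²` of the form depends on `λ` only through a term `|q|²` times the
symbol, and the integral of the difference of two symbols is the difference of the coefficients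
`β_α` (`integral_symb_sub_symb`). Hence `h_α(u, u)` does not depend on `λ`
(`IsDecomp.pointForm_eq`).

Let `ω > 0` be the zero of `β_α`; it exists if `N = 2`, or if `N = 3` and `α < 0`. Computing the
form at `λ = ω` gives `h_α(u, u) ≥ -ω ‖u‖²` (`pointForm_re_ge`), with equality for the multiples of
`G_ω` (`exists_ground_state`). Such multiples as trial functions give
`E(μ) ≤ -ωμ/2 + C μ^{p/2}` (`exists_groundEnergy_le`), which is negative for small `μ` as `p > 2`.
For `x < y` small, a near minimiser `u` of mass `x` therefore has a nonlinear energy of at most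
about `C x^{p/2}`, and a quadratic part close to `-ωx/2`; multiplying `u` by `√(y/x)` lowers the
energy by about `ω(y - x)/2`, up to a relative error that is small with `y`.
-/

noncomputable section

namespace PointNLS

open Real Set Filter Topology FourierTransform

/-! ### The Green function as a time integral of the heat kernel -/

/-- The Laplace weight times the heat kernel: `e^{-λt} (4πt)^{-N/2} e^{-|x|²/(4t)}`, as a function
of the time `t` and of the radius `r = |x|`. Integrated over `t > 0` it yields `G_λ`. -/
def heatWeight (N : ℕ) (lam r t : ℝ) : ℝ :=
  exp (-(lam * t)) * ((4 * π * t) ^ (-(N / 2 : ℝ)) * exp (-(r ^ 2 / (4 * t))))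

/-- The substitution `t = c e^s`. -/
theorem integral_Ioi_eq_integral_exp {c : ℝ} (hc : 0 < c) (F : ℝ → ℝ) :
    ∫ t in Ioi (0 : ℝ), F t = ∫ s : ℝ, c * exp s * F (c * exp s) := by
  have himg : (fun s : ℝ => c * exp s) '' univ = Ioi 0 := by
    rw [image_univ]
    ext t
    simp only [mem_range, mem_Ioi]
    constructor
    · rintro ⟨s, rfl⟩; positivity
    · intro ht
      refine ⟨log (t / c), ?_⟩
      rw [exp_log (by positivity)]
      field_simp
  rw [← himg, integral_image_eq_integral_abs_deriv_smul (f' := fun s => c * exp s)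
    MeasurableSet.univ]
  · simp only [Measure.restrict_univ, smul_eq_mul]
    congr 1 with s
    rw [abs_of_pos (by positivity)]
  · intro s _
    exact ((hasDerivAt_exp s).const_mul c).hasDerivWithinAt
  · intro s _ s' _ h
    simpa [hc.ne'] using h

theorem heatWeight_exponent {lam r : ℝ} (hl : 0 < lam) (hr : 0 < r) (s : ℝ) :
    exp (-(lam * (r / (2 * √lam) * exp s))) * exp (-(r ^ 2 / (4 * (r / (2 * √lam) * exp s)))) =
      exp (-(√lam * r * cosh s)) := by
  have h1 : √lam ≠ 0 := (Real.sqrt_pos.2 hl).ne'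
  have h2 : lam = √lam * √lam := (Real.mul_self_sqrt hl.le).symm
  rw [← exp_add, cosh_eq, exp_neg s]
  congr 1
  have := exp_pos s
  generalize √lam = w at *
  subst h2
  field_simp
  ring

/-- In dimension two the substitution `t = (r / (2√λ)) e^s` turns the time integral of the heat
kernel into the integral defining `K₀`. -/
theorem integral_heatWeight_two {lam r : ℝ} (hl : 0 < lam) (hr : 0 < r) :
    ∫ t in Ioi (0 : ℝ), heatWeight 2 lam r t = 1 / (2 * π) * besselK0 (√lam * r) := by
  have h1 : 0 < √lam := Real.sqrt_pos.2 hl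
  rw [integral_Ioi_eq_integral_exp (c := r / (2 * √lam)) (by positivity)]
  have h : ∀ s : ℝ, r / (2 * √lam) * exp s * heatWeight 2 lam r (r / (2 * √lam) * exp s) =
      1 / (4 * π) * exp (-(√lam * r * cosh |s|)) := by
    intro s
    rw [cosh_abs, ← heatWeight_exponent hl hr, heatWeight]
    have : (-(((2 : ℕ) : ℝ) / 2)) = -1 := by norm_num
    rw [this, rpow_neg_one]
    field_simp
  simp_rw [h]
  rw [integral_const_mul, integral_comp_abs (f := fun s => exp (-(√lam * r * cosh s))), besselK0]
  field_simp
  ring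

theorem integrable_and_integral_cosh_half {z : ℝ} (hz : 0 < z) :
    Integrable (fun s : ℝ => cosh (s / 2) * exp (-(z * cosh s))) ∧
      ∫ s : ℝ, cosh (s / 2) * exp (-(z * cosh s)) = 2 * exp (-z) * √(π / (2 * z)) := by
  have himg : (fun s : ℝ => sinh (s / 2)) '' univ = univ := by
    rw [image_univ, range_eq_univ]
    exact sinh_surjective.comp (fun y => ⟨y * 2, by ring⟩)
  have hd : ∀ s ∈ (univ : Set ℝ),
      HasDerivWithinAt (fun s : ℝ => sinh (s / 2)) (cosh (s / 2) / 2) univ s := by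
    intro s _
    have := (hasDerivAt_sinh (s / 2)).comp s ((hasDerivAt_id s).div_const 2)
    simp only [id, mul_one_div] at this
    exact this.hasDerivWithinAt
  have hinj : InjOn (fun s : ℝ => sinh (s / 2)) univ := by
    intro s _ s' _ h
    have := sinh_injective h
    linarith
  have hfun : (fun s : ℝ => |cosh (s / 2) / 2| • (2 * exp (-z) * exp (-(2 * z) * sinh (s / 2) ^ 2)))
      = fun s : ℝ => cosh (s / 2) * exp (-(z * cosh s)) := by
    ext s
    have h2 : cosh s = 1 + 2 * sinh (s / 2) ^ 2 := by
      have := cosh_two_mul (s / 2)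
      rw [cosh_sq] at this
      rw [show s = 2 * (s / 2) by ring, this]
      ring_nf
    rw [abs_of_pos (by have := cosh_pos (s / 2); positivity), smul_eq_mul, mul_assoc 2,
      ← exp_add, h2]
    ring_nf
  constructor
  · have := (integrableOn_image_iff_integrableOn_abs_deriv_smul MeasurableSet.univ hd hinj
      (fun w => 2 * exp (-z) * exp (-(2 * z) * w ^ 2))).1
        ((integrable_exp_neg_mul_sq (by positivity)).const_mul _).integrableOn
    rwa [hfun, integrableOn_univ] at this
  · have := integral_image_eq_integral_abs_deriv_smul MeasurableSet.univ hd hinj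
      (fun w => 2 * exp (-z) * exp (-(2 * z) * w ^ 2))
    rw [hfun, himg, Measure.restrict_univ, integral_const_mul, integral_gaussian] at this
    exact this.symm

/-- The integrand is symmetrised to `cosh (s / 2) e^{-z cosh s}`, which `w = sinh (s / 2)` turns
into a Gaussian. -/
theorem integral_exp_neg_half {z : ℝ} (hz : 0 < z) :
    ∫ s : ℝ, exp (-(s / 2)) * exp (-(z * cosh s)) = 2 * exp (-z) * √(π / (2 * z)) := by
  obtain ⟨hi, he⟩ := integrable_and_integral_cosh_half hz
  have hint : Integrable (fun s : ℝ => exp (-(s / 2)) * exp (-(z * cosh s))) := by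
    refine (hi.const_mul 2).mono' (by fun_prop) (.of_forall fun s => ?_)
    rw [norm_of_nonneg (by positivity), ← mul_assoc]
    gcongr
    rw [cosh_eq]
    have := exp_pos (s / 2)
    linarith
  have hneg := integral_neg_eq_self (fun s : ℝ => exp (-(s / 2)) * exp (-(z * cosh s))) volume
  have hint' := hint.comp_neg
  have hadd := integral_add hint hint'
  rw [hneg] at hadd
  rw [← he]
  have : ∫ s : ℝ, exp (-(s / 2)) * exp (-(z * cosh s)) + exp (-(-s / 2)) * exp (-(z * cosh (-s)))
      = 2 * ∫ s : ℝ, cosh (s / 2) * exp (-(z * cosh s)) := by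
    rw [← integral_const_mul]
    congr 1 with s
    rw [cosh_neg, cosh_eq (s / 2)]
    ring_nf
  linarith

theorem integral_heatWeight_three {lam r : ℝ} (hl : 0 < lam) (hr : 0 < r) :
    ∫ t in Ioi (0 : ℝ), heatWeight 3 lam r t = exp (-(√lam * r)) / (4 * π * r) := by
  have h1 : 0 < √lam := Real.sqrt_pos.2 hl
  set c := r / (2 * √lam) with hc
  have hc0 : 0 < c := by positivity
  rw [integral_Ioi_eq_integral_exp hc0]
  have h : ∀ s : ℝ, c * exp s * heatWeight 3 lam r (c * exp s) =
      c * (4 * π * c) ^ (-(3 / 2) : ℝ) * (exp (-(s / 2)) * exp (-(√lam * r * cosh s))) := by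
    intro s
    rw [← heatWeight_exponent hl hr, heatWeight, ← hc]
    have h3 : (4 * π * (c * exp s)) ^ (-(((3 : ℕ) : ℝ) / 2)) =
        (4 * π * c) ^ (-(3 / 2) : ℝ) * exp (-(3 / 2 * s)) := by
      rw [← mul_assoc, mul_rpow (by positivity) (exp_pos s).le, ← exp_mul]
      norm_num
      left
      ring
    have h4 : exp (-(s / 2)) = exp s * exp (-(3 / 2 * s)) := by
      rw [← exp_add]; congr 1; ring
    rw [h3, h4]
    ring
  simp_rw [h]
  rw [integral_const_mul, integral_exp_neg_half (by positivity)]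
  have hpow : c * (4 * π * c) ^ (-(3 / 2) : ℝ) = 1 / (4 * π * √(4 * π * c)) := by
    have : (-(3 / 2) : ℝ) = -1 + -(1 / 2) := by norm_num
    rw [this, rpow_add (by positivity), rpow_neg_one, rpow_neg (by positivity), ← sqrt_eq_rpow]
    field_simp
  have hsq : √(π / (2 * (√lam * r))) = √(4 * π * c) / (2 * r) := by
    rw [sqrt_eq_iff_eq_sq (by positivity) (by positivity), div_pow, sq_sqrt (by positivity), hc]
    field_simp
    ring
  rw [hpow, hsq]
  have : √(4 * π * c) ≠ 0 := (Real.sqrt_pos.2 (by positivity)).ne'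
  field_simp

/-- The resolvent is the Laplace transform of the heat semigroup, at the level of kernels. -/
theorem integral_heatWeight_eq_green {N : ℕ} (hN : N = 2 ∨ N = 3) {lam : ℝ} (hl : 0 < lam)
    {x : Space N} (hx : x ≠ 0) :
    ∫ t in Ioi (0 : ℝ), heatWeight N lam ‖x‖ t = green N lam x := by
  have hr : 0 < ‖x‖ := norm_pos_iff.2 hx
  rcases hN with rfl | rfl
  · rw [integral_heatWeight_two hl hr]
    simp [green]
  · rw [integral_heatWeight_three hl hr]
    simp [green]

/-! ### The Fourier transform of the Green function -/

/-- The Fourier symbol `(λ + 4π²|ξ|²)⁻¹` of the resolvent `(-Δ + λ)⁻¹`; the `4π²` comes from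
Mathlib's normalisation `e^{-2πi x·ξ}` of the Fourier transform. -/
def symb {N : ℕ} (lam : ℝ) (ξ : Space N) : ℝ := (lam + 4 * π ^ 2 * ‖ξ‖ ^ 2)⁻¹

theorem symb_denom_pos {N : ℕ} {lam : ℝ} (hl : 0 < lam) (ξ : Space N) :
    0 < lam + 4 * π ^ 2 * ‖ξ‖ ^ 2 := by positivity

theorem symb_pos {N : ℕ} {lam : ℝ} (hl : 0 < lam) (ξ : Space N) : 0 < symb lam ξ :=
  inv_pos.2 (symb_denom_pos hl ξ)

theorem continuous_symb {N : ℕ} {lam : ℝ} (hl : 0 < lam) :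
    Continuous (symb lam : Space N → ℝ) := by
  unfold symb
  exact Continuous.inv₀ (by fun_prop) fun ξ => (symb_denom_pos hl ξ).ne'

theorem memLp_symb {N : ℕ} (hN : N = 2 ∨ N = 3) {lam : ℝ} (hl : 0 < lam) :
    MemLp (fun ξ : Space N => (symb lam ξ : ℂ)) 2 := by
  refine MemLp.ofReal (K := ℂ) ((memLp_two_iff_integrable_sq
    (continuous_symb hl).aestronglyMeasurable).2 ?_)
  have hint : Integrable (fun ξ : Space N => (1 + ‖ξ‖ ^ 2) ^ (-4 / 2 : ℝ)) := by
    apply integrable_rpow_neg_one_add_norm_sq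
    rcases hN with rfl | rfl <;> norm_num
  refine (hint.const_mul ((min lam (4 * π ^ 2))⁻¹ ^ 2)).mono'
    ((continuous_symb hl).pow 2).aestronglyMeasurable (.of_forall fun ξ => ?_)
  have hm : 0 < min lam (4 * π ^ 2) := by positivity
  have : ((1 + ‖ξ‖ ^ 2) ^ (-4 / 2 : ℝ)) = ((1 + ‖ξ‖ ^ 2)⁻¹) ^ 2 := by
    rw [show (-4 / 2 : ℝ) = -((2 : ℕ) : ℝ) by norm_num, rpow_neg (by positivity), rpow_natCast,
      inv_pow]
  rw [this, norm_of_nonneg (by positivity), ← mul_pow, ← mul_inv, symb]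
  gcongr
  nlinarith [min_le_left lam (4 * π ^ 2), min_le_right lam (4 * π ^ 2), sq_nonneg ‖ξ‖]

theorem measurable_heatWeight {N : ℕ} (lam : ℝ) :
    Measurable (fun z : Space N × ℝ => heatWeight N lam ‖z.1‖ z.2) := by
  unfold heatWeight
  fun_prop

theorem heatWeight_nonneg {N : ℕ} {lam r t : ℝ} (ht : 0 < t) : 0 ≤ heatWeight N lam r t := by
  unfold heatWeight
  positivity

theorem heatWeight_ofReal {N : ℕ} {lam t : ℝ} (x : Space N) :
    (heatWeight N lam ‖x‖ t : ℂ) =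
      (exp (-(lam * t)) * (4 * π * t) ^ (-(N / 2 : ℝ)) : ℝ) *
        Complex.exp (-((1 / (4 * t) : ℝ) : ℂ) * ‖x‖ ^ 2) := by
  rw [heatWeight]
  push_cast
  ring_nf

theorem integrable_heatWeight {N : ℕ} {lam t : ℝ} (ht : 0 < t) :
    Integrable (fun x : Space N => (heatWeight N lam ‖x‖ t : ℂ)) := by
  simp_rw [heatWeight_ofReal]
  apply Integrable.const_mul
  have := GaussianFourier.integrable_cexp_neg_mul_sq_norm_add (V := Space N)
    (b := ((1 / (4 * t) : ℝ) : ℂ)) (by rw [Complex.ofReal_re]; positivity) 0 0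
  simpa using this

theorem fourier_heatWeight {N : ℕ} {lam t : ℝ} (ht : 0 < t) (ξ : Space N) :
    𝓕 (fun x : Space N => (heatWeight N lam ‖x‖ t : ℂ)) ξ =
      (exp (-(lam + 4 * π ^ 2 * ‖ξ‖ ^ 2) * t) : ℝ) := by
  have hb : 0 < ((1 / (4 * t) : ℝ) : ℂ).re := by rw [Complex.ofReal_re]; positivity
  have h1 := fourier_gaussian_innerProductSpace (V := Space N) hb ξ
  have hsplit : 𝓕 (fun x : Space N => (heatWeight N lam ‖x‖ t : ℂ)) ξ =
      (exp (-(lam * t)) * (4 * π * t) ^ (-(N / 2 : ℝ)) : ℝ) *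
      𝓕 (fun x : Space N => Complex.exp (-((1 / (4 * t) : ℝ) : ℂ) * ‖x‖ ^ 2)) ξ := by
    simp_rw [heatWeight_ofReal, Real.fourier_eq', smul_eq_mul]
    rw [← integral_const_mul]
    congr 1 with x
    ring
  rw [hsplit, h1]
  have h2 : ((π : ℂ) / ((1 / (4 * t) : ℝ) : ℂ)) ^ (Module.finrank ℝ (Space N) / 2 : ℂ) =
      ((4 * π * t) ^ (N / 2 : ℝ) : ℝ) := by
    rw [Complex.ofReal_cpow (by positivity)]
    simp only [finrank_euclideanSpace, Fintype.card_fin]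
    congr 1
    · push_cast; field_simp
    · push_cast; rfl
  have h3 : Complex.exp (-π ^ 2 * ‖ξ‖ ^ 2 / ((1 / (4 * t) : ℝ) : ℂ)) =
      (exp (-(4 * π ^ 2 * ‖ξ‖ ^ 2 * t)) : ℝ) := by
    push_cast
    congr 1
    field_simp
  rw [h2, h3, ← Complex.ofReal_mul, ← Complex.ofReal_mul]
  congr 1
  have h4 : (4 * π * t) ^ (-(N / 2 : ℝ)) * (4 * π * t) ^ (N / 2 : ℝ) = 1 := by
    rw [← rpow_add (by positivity)]; simp
  calc _ = ((4 * π * t) ^ (-(N / 2 : ℝ)) * (4 * π * t) ^ (N / 2 : ℝ)) *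
        (exp (-(lam * t)) * exp (-(4 * π ^ 2 * ‖ξ‖ ^ 2 * t))) := by ring
    _ = _ := by rw [h4, one_mul, ← exp_add]; ring_nf

theorem integral_norm_heatWeight {N : ℕ} {lam t : ℝ} (ht : 0 < t) :
    ∫ x : Space N, ‖(heatWeight N lam ‖x‖ t : ℂ)‖ = exp (-lam * t) := by
  have h := fourier_heatWeight (N := N) (lam := lam) ht 0
  rw [Real.fourier_eq'] at h
  simp only [inner_zero_right, mul_zero, Complex.ofReal_zero, zero_mul, Complex.exp_zero,
    one_smul, norm_zero, ne_eq, OfNat.ofNat_ne_zero, not_false_eq_true, zero_pow, add_zero] at h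
  rw [integral_complex_ofReal] at h
  have h' := Complex.ofReal_injective h
  rw [← h']
  congr 1 with x
  rw [Complex.norm_real, norm_of_nonneg (heatWeight_nonneg ht)]

theorem integrable_prod_heatWeight (N : ℕ) {lam : ℝ} (hl : 0 < lam) :
    Integrable (fun z : Space N × ℝ => (heatWeight N lam ‖z.1‖ z.2 : ℂ))
      (volume.prod (volume.restrict (Ioi 0))) := by
  have hm : Measurable fun z : Space N × ℝ => (heatWeight N lam ‖z.1‖ z.2 : ℂ) :=
    Complex.measurable_ofReal.comp (measurable_heatWeight lam)
  rw [integrable_prod_iff' hm.aestronglyMeasurable]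
  refine ⟨(ae_restrict_iff' measurableSet_Ioi).2 (.of_forall fun t ht => integrable_heatWeight ht),
    ?_⟩
  have : IntegrableOn (fun t : ℝ => exp (-lam * t)) (Ioi 0) :=
    integrableOn_exp_mul_Ioi (by linarith) 0
  exact this.congr ((ae_restrict_iff' measurableSet_Ioi).2
    (.of_forall fun t ht => (integral_norm_heatWeight ht).symm))

theorem ae_green_eq {N : ℕ} (hN : N = 2 ∨ N = 3) {lam : ℝ} (hl : 0 < lam) :
    ∀ᵐ x : Space N, ∫ t in Ioi (0 : ℝ), (heatWeight N lam ‖x‖ t : ℂ) = (green N lam x : ℂ) := by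
  have : Nonempty (Fin N) := by rcases hN with rfl | rfl <;> infer_instance
  have h0 : ∀ᵐ x : Space N, x ≠ 0 := by
    simp [ae_iff]
  filter_upwards [h0] with x hx
  rw [integral_complex_ofReal, integral_heatWeight_eq_green hN hl hx]

theorem integrable_green {N : ℕ} (hN : N = 2 ∨ N = 3) {lam : ℝ} (hl : 0 < lam) :
    Integrable (fun x : Space N => (green N lam x : ℂ)) :=
  (integrable_prod_heatWeight N hl).integral_prod_left.congr (ae_green_eq hN hl)

/-- The Fourier transform of `G_λ` is the Laplace transform of `e^{-4π²|ξ|²t}` in time. -/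
theorem fourier_green {N : ℕ} (hN : N = 2 ∨ N = 3) {lam : ℝ} (hl : 0 < lam) (ξ : Space N) :
    𝓕 (fun x : Space N => (green N lam x : ℂ)) ξ = symb lam ξ := by
  rw [Real.fourier_eq]
  have h1 : ∫ x : Space N, 𝐞 (-inner ℝ x ξ) • (green N lam x : ℂ) =
      ∫ x : Space N, ∫ t in Ioi (0 : ℝ), 𝐞 (-inner ℝ x ξ) • (heatWeight N lam ‖x‖ t : ℂ) := by
    refine integral_congr_ae ?_
    filter_upwards [ae_green_eq hN hl] with x hx
    simp only [← hx, Circle.smul_def, integral_smul]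
  have hint : Integrable (Function.uncurry fun (x : Space N) (t : ℝ) =>
      𝐞 (-inner ℝ x ξ) • (heatWeight N lam ‖x‖ t : ℂ))
      (volume.prod (volume.restrict (Ioi 0))) := by
    have hi := integrable_prod_heatWeight N hl
    refine hi.mono ?_ (.of_forall fun z => by simp [Function.uncurry, Circle.norm_smul])
    have hc : Continuous fun z : Space N × ℝ => ((𝐞 (-inner ℝ z.1 ξ) : Circle) : ℂ) :=
      continuous_subtype_val.comp (Real.continuous_fourierChar.comp (by fun_prop))
    exact hc.aestronglyMeasurable.mul hi.aestronglyMeasurable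
  rw [h1, integral_integral_swap hint]
  have h2 : ∫ t in Ioi (0 : ℝ), ∫ x : Space N, 𝐞 (-inner ℝ x ξ) • (heatWeight N lam ‖x‖ t : ℂ) =
      ∫ t in Ioi (0 : ℝ), ((exp (-(lam + 4 * π ^ 2 * ‖ξ‖ ^ 2) * t) : ℝ) : ℂ) := by
    refine setIntegral_congr_fun measurableSet_Ioi fun t ht => ?_
    rw [← fourier_heatWeight ht ξ, Real.fourier_eq]
  rw [h2, integral_complex_ofReal,
    integral_exp_mul_Ioi (by linarith [symb_denom_pos hl ξ])]
  congr 1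
  rw [symb]
  rw [mul_zero, exp_zero, neg_div_neg_eq, one_div]

/-- `G_λ` is square integrable, and its `L²` Fourier transform is the symbol of the resolvent:
the inverse `L²` Fourier transform of the symbol and the integrable function `G_λ` agree when
tested against Schwartz functions. -/
theorem exists_greenL2 {N : ℕ} (hN : N = 2 ∨ N = 3) {lam : ℝ} (hl : 0 < lam) :
    ∃ G : L2 N, (∀ᵐ x : Space N, G x = (green N lam x : ℂ)) ∧
      ∀ᵐ ξ : Space N, (𝓕 G : L2 N) ξ = (symb lam ξ : ℂ) := by
  set S : L2 N := (memLp_symb hN hl).toLp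
  have hS : ∀ᵐ ξ : Space N, S ξ = (symb lam ξ : ℂ) := (memLp_symb hN hl).coeFn_toLp
  refine ⟨𝓕⁻ S, ?_, by rw [fourier_fourierInv_eq]; exact hS⟩
  set G : L2 N := 𝓕⁻ S with hG
  have hFG : 𝓕 G = S := fourier_fourierInv_eq S
  apply ae_eq_of_integral_contDiff_smul_eq
  · exact (Lp.memLp G).locallyIntegrable (by norm_num)
  · exact (integrable_green hN hl).locallyIntegrable
  intro g hg hgc
  have hg₁ : HasCompactSupport (Complex.ofRealCLM ∘ g) := hgc.comp_left rfl
  have hg₂ : ContDiff ℝ (↑(⊤ : ℕ∞)) (Complex.ofRealCLM ∘ g) := by fun_prop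
  set χ : 𝓢(Space N, ℂ) := hg₁.toSchwartzMap hg₂
  have hχ : ∀ x, χ x = (g x : ℂ) := fun x => rfl
  set ψ : 𝓢(Space N, ℂ) := 𝓕⁻ χ
  have hψ : 𝓕 ψ = χ := fourier_fourierInv_eq χ
  have e1 : ∫ x, g x • G x = ∫ ξ, ψ ξ * (symb lam ξ : ℂ) := by
    have h1 := Lp.fourier_toTemperedDistribution_eq G
    rw [hFG] at h1
    have h2 := congrArg (fun T : 𝓢'(Space N, ℂ) => T ψ) h1
    simp only [TemperedDistribution.fourier_apply, hψ, Lp.toTemperedDistribution_apply] at h2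
    simp only [hχ, smul_eq_mul] at h2
    simp only [Complex.real_smul]
    rw [h2]
    refine integral_congr_ae ?_
    filter_upwards [hS] with ξ hξ
    rw [hξ]
  have e2 : ∫ x, g x • (green N lam x : ℂ) = ∫ ξ, ψ ξ * (symb lam ξ : ℂ) := by
    have h := VectorFourier.integral_fourierIntegral_smul_eq_flip (L := innerₗ (Space N))
      (μ := volume) (ν := volume) Real.continuous_fourierChar continuous_inner
      (integrable_green hN hl) ψ.integrable
    have hfl : (innerₗ (Space N)).flip = innerₗ (Space N) := flip_innerₗ _
    rw [hfl] at h
    have hr : ∀ x, VectorFourier.fourierIntegral 𝐞 volume (innerₗ (Space N)) ψ x = χ x := by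
      intro x
      rw [← hψ, SchwartzMap.fourier_coe]
      rfl
    have hl' : ∀ ξ, VectorFourier.fourierIntegral 𝐞 volume (innerₗ (Space N))
        (fun x : Space N => (green N lam x : ℂ)) ξ = symb lam ξ := fun ξ => fourier_green hN hl ξ
    simp only [hr, hl', hχ, smul_eq_mul] at h
    simp only [Complex.real_smul]
    calc _ = ∫ x : Space N, (green N lam x : ℂ) * (g x : ℂ) := by congr 1 with x; ring
      _ = ∫ ξ : Space N, (symb lam ξ : ℂ) * ψ ξ := h.symm
      _ = _ := by congr 1 with x; ring
  rw [e1, e2]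

/-! ### Integrals of the symbol of the resolvent -/

/-- The resolvent identity for symbols. -/
theorem symb_sub_symb {N : ℕ} {lam nu : ℝ} (hl : 0 < lam) (hn : 0 < nu) (ξ : Space N) :
    symb lam ξ - symb nu ξ = (nu - lam) * (symb lam ξ * symb nu ξ) := by
  have h1 := (symb_denom_pos hl ξ).ne'
  have h2 := (symb_denom_pos hn ξ).ne'
  unfold symb
  field_simp
  ring

theorem memLp_symb_real {N : ℕ} (hN : N = 2 ∨ N = 3) {lam : ℝ} (hl : 0 < lam) :
    MemLp (symb lam : Space N → ℝ) 2 := (memLp_symb hN hl).re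

theorem integrable_symb_sub_symb {N : ℕ} (hN : N = 2 ∨ N = 3) {lam nu : ℝ} (hl : 0 < lam)
    (hn : 0 < nu) : Integrable (fun ξ : Space N => symb lam ξ - symb nu ξ) := by
  simp_rw [symb_sub_symb hl hn]
  exact ((memLp_symb_real hN hl).integrable_mul (memLp_symb_real hN hn)).const_mul _

theorem tendsto_log_quotient (lam nu : ℝ) :
    Tendsto (fun y : ℝ => log ((lam + 4 * π ^ 2 * y ^ 2) / (nu + 4 * π ^ 2 * y ^ 2)))
      atTop (𝓝 0) := by
  have h1 : Tendsto (fun y : ℝ => (y ^ 2)⁻¹) atTop (𝓝 0) :=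
    (tendsto_pow_atTop two_ne_zero).inv_tendsto_atTop
  have h2 : Tendsto (fun y : ℝ => (lam * (y ^ 2)⁻¹ + 4 * π ^ 2) / (nu * (y ^ 2)⁻¹ + 4 * π ^ 2))
      atTop (𝓝 ((lam * 0 + 4 * π ^ 2) / (nu * 0 + 4 * π ^ 2))) :=
    ((h1.const_mul lam).add_const _).div ((h1.const_mul nu).add_const _)
      (by rw [mul_zero, zero_add]; positivity)
  have h3 : (lam * 0 + 4 * π ^ 2) / (nu * 0 + 4 * π ^ 2) = 1 := by
    field_simp
    simp
  rw [h3] at h2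
  have h4 := h2.log one_ne_zero
  rw [log_one] at h4
  refine h4.congr' ?_
  filter_upwards [eventually_gt_atTop 0] with y hy
  congr 1
  have : (lam + 4 * π ^ 2 * y ^ 2) = (lam * (y ^ 2)⁻¹ + 4 * π ^ 2) * y ^ 2 := by field_simp
  rw [this]
  have : (nu + 4 * π ^ 2 * y ^ 2) = (nu * (y ^ 2)⁻¹ + 4 * π ^ 2) * y ^ 2 := by field_simp
  rw [this, mul_div_mul_right _ _ (by positivity)]

theorem tendsto_arctan_scaled {w : ℝ} (hw : 0 < w) :
    Tendsto (fun y : ℝ => w / (8 * π ^ 3) * arctan (2 * π * y / w)) atTop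
      (𝓝 (w / (8 * π ^ 3) * (π / 2))) := by
  have h : Tendsto (fun y : ℝ => 2 * π * y / w) atTop atTop :=
    (tendsto_id.const_mul_atTop (by positivity)).atTop_div_const hw
  exact (((tendsto_arctan_atTop.mono_right nhdsWithin_le_nhds).comp h).const_mul _)

/-- The difference of two symbols integrates to the difference of the coefficients `β_α`: this is
the identity by which the form `h_α` does not depend on `λ`. -/
theorem integral_symb_sub_symb {N : ℕ} (hN : N = 2 ∨ N = 3) (α : ℝ) {lam nu : ℝ} (hl : 0 < lam)
    (hn : 0 < nu) :
    ∫ ξ : Space N, (symb lam ξ - symb nu ξ) = betaCoeff N α nu - betaCoeff N α lam := by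
  have : Nontrivial (Space N) := by rcases hN with rfl | rfl <;> infer_instance
  set f : ℝ → ℝ := fun y => (lam + 4 * π ^ 2 * y ^ 2)⁻¹ - (nu + 4 * π ^ 2 * y ^ 2)⁻¹ with hf
  have hint := (integrable_fun_norm_addHaar (volume : Measure (Space N)) (f := f)).1
    (integrable_symb_sub_symb hN hl hn)
  have hpolar := integral_fun_norm_addHaar (volume : Measure (Space N)) f
  have e0 : ∫ ξ : Space N, (symb lam ξ - symb nu ξ) = ∫ ξ : Space N, f ‖ξ‖ := rfl
  have p1 : ∀ y : ℝ, 0 < lam + 4 * π ^ 2 * y ^ 2 := fun y => by positivity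
  have p2 : ∀ y : ℝ, 0 < nu + 4 * π ^ 2 * y ^ 2 := fun y => by positivity
  rw [e0, hpolar]
  rcases hN with rfl | rfl
  · have hd : ∀ y ∈ Ici (0 : ℝ), HasDerivAt
        (fun y : ℝ => 1 / (8 * π ^ 2) *
          log ((lam + 4 * π ^ 2 * y ^ 2) / (nu + 4 * π ^ 2 * y ^ 2)))
        (y ^ (Module.finrank ℝ (Space 2) - 1) • f y) y := by
      intro y _
      have a1 : HasDerivAt (fun y : ℝ => lam + 4 * π ^ 2 * y ^ 2) (4 * π ^ 2 * (2 * y)) y := by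
        simpa using ((hasDerivAt_pow 2 y).const_mul (4 * π ^ 2)).const_add lam
      have a2 : HasDerivAt (fun y : ℝ => nu + 4 * π ^ 2 * y ^ 2) (4 * π ^ 2 * (2 * y)) y := by
        simpa using ((hasDerivAt_pow 2 y).const_mul (4 * π ^ 2)).const_add nu
      have := ((a1.div a2 (p2 y).ne').log (div_pos (p1 y) (p2 y)).ne').const_mul (1 / (8 * π ^ 2))
      refine this.congr_deriv ?_
      have q1 := (p1 y).ne'
      have q2 := (p2 y).ne'
      simp only [finrank_euclideanSpace, Fintype.card_fin, smul_eq_mul, hf, Pi.div_apply]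
      field_simp
      ring
    rw [integral_Ioi_of_hasDerivAt_of_tendsto' hd hint
      ((tendsto_log_quotient lam nu).const_mul _)]
    have hball : (volume : Measure (Space 2)).real (Metric.ball 0 1) = π := by
      rw [Measure.real, EuclideanSpace.volume_ball_fin_two]
      simp [pi_pos.le]
    rw [hball]
    simp only [finrank_euclideanSpace, Fintype.card_fin, smul_eq_mul, nsmul_eq_mul, betaCoeff,
      if_true]
    rw [log_sqrt hl.le, log_sqrt hn.le]
    simp only [mul_zero, ne_eq, OfNat.ofNat_ne_zero, not_false_eq_true, zero_pow, add_zero]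
    rw [log_div hl.ne' hn.ne']
    push_cast
    field_simp
    ring
  · have hsl := Real.sqrt_pos.2 hl
    have hsn := Real.sqrt_pos.2 hn
    have hd : ∀ y ∈ Ici (0 : ℝ), HasDerivAt
        (fun y : ℝ => √nu / (8 * π ^ 3) * arctan (2 * π * y / √nu) -
          √lam / (8 * π ^ 3) * arctan (2 * π * y / √lam))
        (y ^ (Module.finrank ℝ (Space 3) - 1) • f y) y := by
      intro y _
      have a : ∀ w : ℝ, 0 < w → HasDerivAt (fun y : ℝ => w / (8 * π ^ 3) * arctan (2 * π * y / w))
          (w ^ 2 / (4 * π ^ 2) * (w ^ 2 + 4 * π ^ 2 * y ^ 2)⁻¹) y := by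
        intro w hw
        have b : HasDerivAt (fun y : ℝ => 2 * π * y / w) (2 * π / w) y := by
          simpa using ((hasDerivAt_id y).const_mul (2 * π)).div_const w
        refine ((b.arctan).const_mul (w / (8 * π ^ 3))).congr_deriv ?_
        have : w ^ 2 + 4 * π ^ 2 * y ^ 2 ≠ 0 := by positivity
        have : 1 + (2 * π * y / w) ^ 2 ≠ 0 := by positivity
        field_simp
        ring
      refine ((a _ hsn).sub (a _ hsl)).congr_deriv ?_
      have q1 := (p1 y).ne'
      have q2 := (p2 y).ne'
      rw [sq_sqrt hl.le, sq_sqrt hn.le]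
      simp only [finrank_euclideanSpace, Fintype.card_fin, smul_eq_mul, hf]
      field_simp
      ring
    rw [integral_Ioi_of_hasDerivAt_of_tendsto' hd hint
      ((tendsto_arctan_scaled hsn).sub (tendsto_arctan_scaled hsl))]
    have hball : (volume : Measure (Space 3)).real (Metric.ball 0 1) = π * 4 / 3 := by
      rw [Measure.real, EuclideanSpace.volume_ball_fin_three]
      simp
      positivity
    rw [hball]
    simp [betaCoeff]
    field_simp
    ring

/-- `G_λ` just fails to have a square integrable gradient: `|ξ|² (λ + 4π²|ξ|²)⁻²` decays like
`|ξ|⁻²`, and `N ≥ 2`. -/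
theorem not_memLp_norm_mul_symb {N : ℕ} (hN : N = 2 ∨ N = 3) {lam : ℝ} (hl : 0 < lam) :
    ¬ MemLp (fun ξ : Space N => ‖ξ‖ * symb lam ξ) 2 := by
  have : Nontrivial (Space N) := by rcases hN with rfl | rfl <;> infer_instance
  intro h
  have h1 := h.integrable_sq
  have h2 := (integrable_fun_norm_addHaar (volume : Measure (Space N))
    (f := fun y => (y * (lam + 4 * π ^ 2 * y ^ 2)⁻¹) ^ 2)).1 h1
  have h3 : IntegrableOn (fun y : ℝ => y⁻¹) (Ioi (1 + lam)) := by
    refine ((h2.mono_set (Ioi_subset_Ioi (by linarith : (0 : ℝ) ≤ 1 + lam))).const_mul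
      ((1 + 4 * π ^ 2) ^ 2)).mono' (by fun_prop) ?_
    refine (ae_restrict_iff' measurableSet_Ioi).2 (.of_forall fun y hy => ?_)
    have hy1 : 1 + lam < y := hy
    have hy0 : 0 < y := by linarith
    have hpow : y ≤ y ^ (Module.finrank ℝ (Space N) - 1) := by
      rcases hN with rfl | rfl
      · simp
      · simp; nlinarith
    have hle : lam + 4 * π ^ 2 * y ^ 2 ≤ (1 + 4 * π ^ 2) * y ^ 2 := by nlinarith
    rw [norm_of_nonneg (by positivity), smul_eq_mul]
    calc y⁻¹ = (1 + 4 * π ^ 2) ^ 2 * (y * (y * ((1 + 4 * π ^ 2) * y ^ 2)⁻¹) ^ 2) := by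
          field_simp
      _ ≤ _ := by gcongr
  exact not_integrableOn_Ioi_inv h3

theorem norm_mul_symb_le {N : ℕ} {nu : ℝ} (hn : 0 < nu) (ξ : Space N) :
    ‖ξ‖ * symb nu ξ ≤ 1 + 1 / nu := by
  rw [symb, ← div_eq_mul_inv, div_le_iff₀ (symb_denom_pos hn ξ)]
  have h1 : (1 + 1 / nu) * (nu + 4 * π ^ 2 * ‖ξ‖ ^ 2) =
      nu + 1 + 4 * π ^ 2 * ‖ξ‖ ^ 2 + 1 / nu * (4 * π ^ 2 * ‖ξ‖ ^ 2) := by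
    field_simp
    ring
  have h2 : 0 ≤ 1 / nu * (4 * π ^ 2 * ‖ξ‖ ^ 2) := by positivity
  have h3 : 1 ≤ π ^ 2 := by nlinarith [pi_gt_three]
  nlinarith [sq_nonneg (‖ξ‖ - 1), sq_nonneg ‖ξ‖]

/-- The charge is determined by the function, also when the decompositions use different values
of `λ`. -/
theorem charge_eq_of_memLp {N : ℕ} (hN : N = 2 ∨ N = 3) {lam nu : ℝ} (hl : 0 < lam) (hn : 0 < nu)
    {q q' : ℂ}
    (h : MemLp (fun ξ : Space N => (‖ξ‖ : ℂ) * (q * symb lam ξ - q' * symb nu ξ)) 2) :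
    q = q' := by
  have hprod : MemLp (fun ξ : Space N => (‖ξ‖ : ℂ) * ((symb lam ξ : ℂ) * symb nu ξ)) 2 := by
    refine ((memLp_symb hN hl).const_mul ((1 + 1 / nu : ℝ) : ℂ)).mono ?_ (.of_forall fun ξ => ?_)
    · have c1 := continuous_symb (N := N) hl
      have c2 := continuous_symb (N := N) hn
      exact Continuous.aestronglyMeasurable (by fun_prop)
    · simp only [norm_mul, Complex.norm_real]
      rw [norm_of_nonneg (norm_nonneg ξ), norm_of_nonneg (symb_pos hl ξ).le,
        norm_of_nonneg (symb_pos hn ξ).le, norm_of_nonneg (by positivity : 0 ≤ 1 + 1 / nu)]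
      nlinarith [norm_mul_symb_le hn ξ, symb_pos hl ξ]
  by_contra hne
  have hd : q - q' ≠ 0 := sub_ne_zero.2 hne
  have h1 := (h.sub (hprod.const_mul (q' * (nu - lam)))).const_mul (q - q')⁻¹
  refine not_memLp_norm_mul_symb hN hl ((h1.re).ae_eq (.of_forall fun ξ => ?_))
  have hs : (symb nu ξ : ℂ) = symb lam ξ - (nu - lam) * (symb lam ξ * symb nu ξ) := by
    have := symb_sub_symb hl hn ξ
    have h' : symb nu ξ = symb lam ξ - (nu - lam) * (symb lam ξ * symb nu ξ) := by linarith
    exact_mod_cast h'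
  have : (q - q')⁻¹ * ((‖ξ‖ : ℂ) * (q * symb lam ξ - q' * symb nu ξ) -
      q' * (nu - lam) * ((‖ξ‖ : ℂ) * ((symb lam ξ : ℂ) * symb nu ξ))) =
      ((‖ξ‖ * symb lam ξ : ℝ) : ℂ) := by
    have h2 : (‖ξ‖ : ℂ) * (q * symb lam ξ - q' * symb nu ξ) -
      q' * (nu - lam) * ((‖ξ‖ : ℂ) * ((symb lam ξ : ℂ) * symb nu ξ)) =
        (q - q') * (‖ξ‖ * symb lam ξ) := by
      linear_combination (-(‖ξ‖ : ℂ) * q') * hs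
    rw [h2]
    push_cast
    field_simp
  simp only [Pi.sub_apply, this]
  simp

/-! ### Weak derivatives on the Fourier side -/

theorem IsWeakPartial.fourier_ae_eq {N : ℕ} {i : Fin N} {φ g : L2 N} (h : IsWeakPartial i φ g) :
    ∀ᵐ ξ : Space N, (𝓕 g : L2 N) ξ = 2 * π * Complex.I * (ξ i : ℂ) * (𝓕 φ : L2 N) ξ := by
  have hg : 𝓕 (g : 𝓢'(Space N, ℂ)) = (2 * π * Complex.I) • TemperedDistribution.smulLeftCLM ℂ
      (fun ξ : Space N => ((inner ℝ ξ (EuclideanSpace.single i (1 : ℝ)) : ℝ) : ℂ))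
        (𝓕 (φ : 𝓢'(Space N, ℂ))) := by
    rw [← TemperedDistribution.fourier_lineDerivOp_eq, ← h]
  rw [Lp.fourier_toTemperedDistribution_eq, Lp.fourier_toTemperedDistribution_eq] at hg
  have hloc := (Lp.memLp (𝓕 φ : L2 N)).locallyIntegrable (by norm_num)
  have hloc' : LocallyIntegrable
      (fun ξ : Space N => 2 * π * Complex.I * (ξ i : ℂ) * (𝓕 φ : L2 N) ξ) := by
    rw [← locallyIntegrableOn_univ] at hloc ⊢
    refine hloc.continuousOn_mul (Continuous.continuousOn ?_) isOpen_univ.isLocallyClosed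
    fun_prop
  refine ae_eq_of_integral_contDiff_smul_eq
    ((Lp.memLp (𝓕 g : L2 N)).locallyIntegrable (by norm_num)) hloc' fun χ hχ hχc => ?_
  have h₁ : HasCompactSupport (Complex.ofRealCLM ∘ χ) := hχc.comp_left rfl
  have h₂ : ContDiff ℝ (↑(⊤ : ℕ∞)) (Complex.ofRealCLM ∘ χ) := by fun_prop
  have h3 := congrArg (fun T : 𝓢'(Space N, ℂ) => T (h₁.toSchwartzMap h₂)) hg
  have ht : (fun ξ : Space N =>
      ((inner ℝ ξ (EuclideanSpace.single i (1 : ℝ)) : ℝ) : ℂ)).HasTemperateGrowth := by fun_prop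
  simp only [Lp.toTemperedDistribution_apply, smul_apply,
    TemperedDistribution.smulLeftCLM_apply_apply, SchwartzMap.smulLeftCLM_apply_apply ht] at h3
  rw [smul_eq_mul, ← integral_const_mul] at h3
  have e1 : ∀ x, (h₁.toSchwartzMap h₂) x = (χ x : ℂ) := fun x => rfl
  simp only [e1] at h3
  calc ∫ x, χ x • (𝓕 g : L2 N) x = ∫ x, (χ x : ℂ) • (𝓕 g : L2 N) x := by
        congr 1
    _ = _ := h3
    _ = _ := by
        congr 1 with x
        simp only [EuclideanSpace.inner_single_right, smul_eq_mul, Complex.real_smul]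
        simp
        ring

theorem MemH1.isWeakPartial_weakPartial {N : ℕ} {φ : L2 N} (hφ : MemH1 φ) (i : Fin N) :
    IsWeakPartial i φ (weakPartial i φ) := by
  have h := hφ.exists_weakPartial i
  rw [weakPartial, dif_pos h]
  exact h.choose_spec

theorem L2.integrable_norm_sq {N : ℕ} (f : L2 N) : Integrable (fun x => ‖f x‖ ^ 2) :=
  (memLp_two_iff_integrable_sq_norm (Lp.aestronglyMeasurable f)).1 (Lp.memLp f)

theorem L2.norm_sq_eq_integral {N : ℕ} (f : L2 N) : ‖f‖ ^ 2 = ∫ x, ‖f x‖ ^ 2 := by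
  have h := MeasureTheory.L2.inner_def (𝕜 := ℂ) f f
  rw [inner_self_eq_norm_sq_to_K] at h
  simp only [inner_self_eq_norm_sq_to_K] at h
  have : ∫ x, ((‖f x‖ : ℂ)) ^ 2 = ((∫ x, ‖f x‖ ^ 2 : ℝ) : ℂ) := by
    rw [← integral_complex_ofReal]
    push_cast
    rfl
  rw [show ∫ x, ((RCLike.ofReal ‖f x‖ : ℂ)) ^ 2 = ∫ x, ((‖f x‖ : ℂ)) ^ 2 from rfl, this] at h
  exact Complex.ofReal_injective ((Complex.ofReal_pow _ _).trans h)

theorem norm_sq_fourier_weakPartial {N : ℕ} {φ : L2 N} (hφ : MemH1 φ) (i : Fin N) :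
    ∀ᵐ ξ : Space N, ‖(𝓕 (weakPartial i φ) : L2 N) ξ‖ ^ 2 =
      4 * π ^ 2 * ξ i ^ 2 * ‖(𝓕 φ : L2 N) ξ‖ ^ 2 := by
  filter_upwards [(hφ.isWeakPartial_weakPartial i).fourier_ae_eq] with ξ hξ
  rw [hξ]
  simp only [norm_mul, Complex.norm_real, Complex.norm_I, Complex.norm_ofNat, mul_pow, norm_eq_abs,
    sq_abs]
  ring

theorem MemH1.ae_sum_norm_sq {N : ℕ} {φ : L2 N} (hφ : MemH1 φ) :
    ∀ᵐ ξ : Space N, ∑ i : Fin N, ‖(𝓕 (weakPartial i φ) : L2 N) ξ‖ ^ 2 =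
      4 * π ^ 2 * ‖ξ‖ ^ 2 * ‖(𝓕 φ : L2 N) ξ‖ ^ 2 := by
  filter_upwards [ae_all_iff.2 (norm_sq_fourier_weakPartial hφ)] with ξ hξ
  simp only [hξ]
  rw [← Finset.sum_mul, ← Finset.mul_sum, EuclideanSpace.real_norm_sq_eq]

theorem MemH1.integrable_gradient {N : ℕ} {φ : L2 N} (hφ : MemH1 φ) :
    Integrable (fun ξ : Space N => 4 * π ^ 2 * ‖ξ‖ ^ 2 * ‖(𝓕 φ : L2 N) ξ‖ ^ 2) :=
  (integrable_finsetSum _ fun _ _ => L2.integrable_norm_sq _).congr hφ.ae_sum_norm_sq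

/-- Plancherel for the Dirichlet integral. -/
theorem MemH1.sum_norm_sq_weakPartial {N : ℕ} {φ : L2 N} (hφ : MemH1 φ) :
    ∑ i : Fin N, ‖weakPartial i φ‖ ^ 2 =
      ∫ ξ : Space N, 4 * π ^ 2 * ‖ξ‖ ^ 2 * ‖(𝓕 φ : L2 N) ξ‖ ^ 2 := by
  rw [← integral_congr_ae hφ.ae_sum_norm_sq,
    integral_finsetSum _ fun _ _ => L2.integrable_norm_sq _]
  refine Finset.sum_congr rfl fun i _ => ?_
  rw [← L2.norm_sq_eq_integral, Lp.norm_fourier_eq]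

theorem MemH1.memLp_norm_mul {N : ℕ} {φ : L2 N} (hφ : MemH1 φ) :
    MemLp (fun ξ : Space N => (‖ξ‖ : ℂ) * (𝓕 φ : L2 N) ξ) 2 := by
  have hm : AEStronglyMeasurable (fun ξ : Space N => (‖ξ‖ : ℂ) * (𝓕 φ : L2 N) ξ) :=
    (Continuous.aestronglyMeasurable (by fun_prop)).mul (Lp.aestronglyMeasurable _)
  rw [memLp_two_iff_integrable_sq_norm hm]
  refine (hφ.integrable_gradient.const_mul (4 * π ^ 2)⁻¹).congr (.of_forall fun ξ => ?_)
  simp only [norm_mul, Complex.norm_real, norm_norm, mul_pow]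
  field_simp

/-! ### The quadratic form on the Fourier side -/

/-- The Fourier side of a decomposition `u = φ + q G_λ`. -/
theorem IsDecomp.fourier_ae_eq {N : ℕ} (hN : N = 2 ∨ N = 3) {lam : ℝ} (hl : 0 < lam)
    {u φ : L2 N} {q : ℂ} (h : IsDecomp lam u φ q) :
    ∀ᵐ ξ : Space N, (𝓕 φ : L2 N) ξ = (𝓕 u : L2 N) ξ - q * symb lam ξ := by
  obtain ⟨G, hG, hFG⟩ := exists_greenL2 hN hl
  have hφ : φ = u - q • G := by
    apply Lp.ext
    filter_upwards [h.2, hG, Lp.coeFn_sub u (q • G), Lp.coeFn_smul q G] with x h1 h2 h3 h4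
    rw [h3, Pi.sub_apply, h4, Pi.smul_apply, h2, h1, smul_eq_mul]
    ring
  have hF : 𝓕 φ = 𝓕 u - q • 𝓕 G := by
    rw [hφ]
    exact ((Lp.fourierTransformₗᵢ (Space N) ℂ).map_sub u (q • G)).trans
      (congrArg _ ((Lp.fourierTransformₗᵢ (Space N) ℂ).map_smul q G))
  rw [hF]
  filter_upwards [hFG, Lp.coeFn_sub (𝓕 u) (q • 𝓕 G), Lp.coeFn_smul q (𝓕 G)] with ξ h2 h3 h4
  rw [h3, Pi.sub_apply, h4, Pi.smul_apply, h2, smul_eq_mul]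

theorem IsDecomp.charge_unique {N : ℕ} (hN : N = 2 ∨ N = 3) {lam nu : ℝ} (hl : 0 < lam)
    (hn : 0 < nu) {u φ φ' : L2 N} {q q' : ℂ} (h : IsDecomp lam u φ q)
    (h' : IsDecomp nu u φ' q') : q = q' := by
  refine charge_eq_of_memLp hN hl hn ((h'.1.memLp_norm_mul.sub h.1.memLp_norm_mul).ae_eq ?_)
  filter_upwards [h.fourier_ae_eq hN hl, h'.fourier_ae_eq hN hn] with ξ h1 h2
  rw [Pi.sub_apply, h1, h2]
  ring

theorem IsDecomp.regular_unique {N : ℕ} {lam : ℝ} {u φ φ' : L2 N} {q : ℂ}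
    (h : IsDecomp lam u φ q) (h' : IsDecomp lam u φ' q) : φ = φ' := by
  apply Lp.ext
  filter_upwards [h.2, h'.2] with x h1 h2
  exact add_right_cancel (h1.symm.trans h2)

/-- The density on the Fourier side of `h_α(u, u) - β_α(λ)|q|²`, where `f = 𝓕 u`. -/
def formDensity {N : ℕ} (lam : ℝ) (q : ℂ) (f : Space N → ℂ) (ξ : Space N) : ℝ :=
  (4 * π ^ 2 * ‖ξ‖ ^ 2 + lam) * ‖f ξ - q * symb lam ξ‖ ^ 2 - lam * ‖f ξ‖ ^ 2

/-- Expanding the square, `λ` enters only through the last term of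
`4π²|ξ|² |f|² - 2 Re (f conj q) + |q|² symb λ`. -/
theorem formDensity_sub {N : ℕ} {lam nu : ℝ} (hl : 0 < lam) (hn : 0 < nu) (q : ℂ)
    (f : Space N → ℂ) (ξ : Space N) :
    formDensity lam q f ξ - formDensity nu q f ξ = ‖q‖ ^ 2 * (symb lam ξ - symb nu ξ) := by
  have key : ∀ m : ℝ, 0 < m → formDensity m q f ξ = 4 * π ^ 2 * ‖ξ‖ ^ 2 * ‖f ξ‖ ^ 2
      - 2 * ((f ξ).re * q.re + (f ξ).im * q.im) + ‖q‖ ^ 2 * symb m ξ := by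
    intro m hm
    have h1 : (4 * π ^ 2 * ‖ξ‖ ^ 2 + m) * symb m ξ = 1 := by
      rw [symb, add_comm, mul_inv_cancel₀ (symb_denom_pos hm ξ).ne']
    rw [formDensity]
    simp only [← Complex.normSq_eq_norm_sq, Complex.normSq_apply, Complex.sub_re, Complex.sub_im,
      Complex.mul_re, Complex.mul_im, Complex.ofReal_re, Complex.ofReal_im]
    linear_combination (symb m ξ * (q.re ^ 2 + q.im ^ 2)
      - 2 * ((f ξ).re * q.re + (f ξ).im * q.im)) * h1
  rw [key lam hl, key nu hn]
  ring

theorem formDensity_shift {N : ℕ} (hN : N = 2 ∨ N = 3) (α : ℝ) {lam nu : ℝ} (hl : 0 < lam)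
    (hn : 0 < nu) (q : ℂ) (f : Space N → ℂ) (hi : Integrable (formDensity lam q f)) :
    Integrable (formDensity nu q f) ∧
      (∫ ξ, formDensity lam q f ξ) + betaCoeff N α lam * ‖q‖ ^ 2 =
        (∫ ξ, formDensity nu q f ξ) + betaCoeff N α nu * ‖q‖ ^ 2 := by
  have hs := (integrable_symb_sub_symb hN hl hn).const_mul (‖q‖ ^ 2)
  have he : formDensity nu q f =
      fun ξ => formDensity lam q f ξ - ‖q‖ ^ 2 * (symb lam ξ - symb nu ξ) := by
    ext ξ
    linarith [formDensity_sub hl hn q f ξ]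
  refine ⟨by rw [he]; exact hi.sub hs, ?_⟩
  rw [he, integral_sub hi hs, integral_const_mul, integral_symb_sub_symb hN α hl hn]
  ring

/-- The form `h_α(u, u)` computed through a decomposition, on the Fourier side. -/
theorem IsDecomp.form_eq {N : ℕ} (hN : N = 2 ∨ N = 3) (α : ℝ) {lam : ℝ} (hl : 0 < lam)
    {u φ : L2 N} {q : ℂ} (h : IsDecomp lam u φ q) :
    Integrable (formDensity lam q (𝓕 u : L2 N)) ∧
    ∑ i : Fin N, inner ℂ (weakPartial i φ) (weakPartial i φ)
      + (lam : ℂ) * (inner ℂ φ φ - inner ℂ u u)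
      + (betaCoeff N α lam : ℂ) * (q * (starRingEnd ℂ) q) =
    (((∫ ξ, formDensity lam q (𝓕 u : L2 N) ξ) + betaCoeff N α lam * ‖q‖ ^ 2 : ℝ) : ℂ) := by
  have hadd : Integrable (fun ξ : Space N => 4 * π ^ 2 * ‖ξ‖ ^ 2 * ‖(𝓕 φ : L2 N) ξ‖ ^ 2
      + lam * ‖(𝓕 φ : L2 N) ξ‖ ^ 2) :=
    h.1.integrable_gradient.add ((L2.integrable_norm_sq _).const_mul lam)
  have hint := hadd.sub ((L2.integrable_norm_sq (𝓕 u)).const_mul lam)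
  have hae : ∀ᵐ ξ : Space N, 4 * π ^ 2 * ‖ξ‖ ^ 2 * ‖(𝓕 φ : L2 N) ξ‖ ^ 2
      + lam * ‖(𝓕 φ : L2 N) ξ‖ ^ 2 - lam * ‖(𝓕 u : L2 N) ξ‖ ^ 2 =
        formDensity lam q (𝓕 u : L2 N) ξ := by
    filter_upwards [h.fourier_ae_eq hN hl] with ξ h1
    rw [formDensity, h1]
    ring
  refine ⟨hint.congr hae, ?_⟩
  rw [← integral_congr_ae hae, integral_sub hadd ((L2.integrable_norm_sq _).const_mul lam),
    integral_add h.1.integrable_gradient ((L2.integrable_norm_sq _).const_mul lam),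
    integral_const_mul, integral_const_mul, ← h.1.sum_norm_sq_weakPartial,
    ← L2.norm_sq_eq_integral, ← L2.norm_sq_eq_integral, Lp.norm_fourier_eq, Lp.norm_fourier_eq,
    Complex.mul_conj, Complex.normSq_eq_norm_sq]
  simp only [inner_self_eq_norm_sq_to_K]
  push_cast
  simp only [Complex.coe_algebraMap]
  ring

/-- The form does not depend on the decomposition, so that any of them computes it. -/
theorem IsDecomp.pointForm_eq {N : ℕ} (hN : N = 2 ∨ N = 3) (α : ℝ) {lam : ℝ} (hl : 0 < lam)
    {u φ : L2 N} {q : ℂ} (h : IsDecomp lam u φ q) :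
    pointForm α u u =
      (((∫ ξ, formDensity lam q (𝓕 u : L2 N) ξ) + betaCoeff N α lam * ‖q‖ ^ 2 : ℝ) : ℂ) := by
  have hex : ∃ z : ℂ, IsFormValue α u u z := ⟨_, lam, φ, φ, q, q, hl, h, h, rfl⟩
  rw [pointForm, dif_pos hex]
  obtain ⟨nu, φ₁, φ₂, q₁, q₂, hn, h₁, h₂, hz⟩ := hex.choose_spec
  obtain rfl : q = q₁ := h.charge_unique hN hl hn h₁
  obtain rfl : q = q₂ := h.charge_unique hN hl hn h₂
  obtain rfl : φ₁ = φ₂ := h₁.regular_unique h₂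
  rw [hz, (h₁.form_eq hN α hn).2]
  congr 1
  exact ((formDensity_shift hN α hl hn q _ (h.form_eq hN α hl).1).2).symm

/-- If `β_α(ω) = 0` then `-ω` is a lower bound of the form: at `λ = ω` only the term `-ω ‖u‖²`
is negative. -/
theorem pointForm_re_ge {N : ℕ} (hN : N = 2 ∨ N = 3) {α ω : ℝ} (hω : 0 < ω)
    (hβ : betaCoeff N α ω = 0) {u : L2 N} (hu : MemEnergySpace u) :
    -ω * ‖u‖ ^ 2 ≤ (pointForm α u u).re := by
  obtain ⟨lam, φ, q, hl, h⟩ := hu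
  obtain ⟨hi, he⟩ := formDensity_shift hN α hl hω q _ (h.form_eq hN α hl).1
  rw [h.pointForm_eq hN α hl, Complex.ofReal_re, he, hβ, zero_mul, add_zero,
    ← Lp.norm_fourier_eq, L2.norm_sq_eq_integral, ← integral_const_mul]
  refine integral_mono ((L2.integrable_norm_sq _).const_mul _) hi fun ξ => ?_
  have : 0 ≤ (4 * π ^ 2 * ‖ξ‖ ^ 2 + ω) * ‖(𝓕 u : L2 N) ξ - q * symb ω ξ‖ ^ 2 := by positivity
  simp only [formDensity]
  linarith

theorem memH1_zero (N : ℕ) : MemH1 (0 : L2 N) := by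
  have h : Lp.toTemperedDistribution (0 : L2 N) = (0 : 𝓢'(Space N, ℂ)) :=
    (Lp.toTemperedDistributionCLM ℂ (volume : Measure (Space N)) 2).map_zero
  rw [MemH1, h]
  exact TemperedDistribution.memSobolev_fun_zero _ _ _ _

theorem MemH1.smul {N : ℕ} {φ : L2 N} (hφ : MemH1 φ) (c : ℂ) : MemH1 (c • φ) := by
  have h : Lp.toTemperedDistribution (c • φ) = c • (φ : 𝓢'(Space N, ℂ)) :=
    (Lp.toTemperedDistributionCLM ℂ (volume : Measure (Space N)) 2).map_smul c φ
  rw [MemH1, h]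
  exact TemperedDistribution.MemSobolev.smul c hφ

theorem IsDecomp.smul {N : ℕ} {lam : ℝ} {u φ : L2 N} {q : ℂ} (h : IsDecomp lam u φ q) (c : ℂ) :
    IsDecomp lam (c • u) (c • φ) (c * q) := by
  refine ⟨h.1.smul c, ?_⟩
  filter_upwards [h.2, Lp.coeFn_smul c u, Lp.coeFn_smul c φ] with x h1 h2 h3
  rw [h2, h3, Pi.smul_apply, Pi.smul_apply, h1, smul_eq_mul, smul_eq_mul]
  ring

theorem MemEnergySpace.smul {N : ℕ} {u : L2 N} (h : MemEnergySpace u) (c : ℂ) :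
    MemEnergySpace (c • u) := by
  obtain ⟨lam, φ, q, hl, hd⟩ := h
  exact ⟨lam, c • φ, c * q, hl, hd.smul c⟩

theorem pointForm_smul {N : ℕ} (hN : N = 2 ∨ N = 3) (α : ℝ) {u : L2 N} (hu : MemEnergySpace u)
    (c : ℂ) : (pointForm α (c • u) (c • u)).re = ‖c‖ ^ 2 * (pointForm α u u).re := by
  obtain ⟨lam, φ, q, hl, h⟩ := hu
  rw [h.pointForm_eq hN α hl, (h.smul c).pointForm_eq hN α hl, Complex.ofReal_re,
    Complex.ofReal_re, mul_add, ← integral_const_mul]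
  congr 1
  · refine integral_congr_ae ?_
    have hF : (𝓕 (c • u) : L2 N) = c • 𝓕 u := (Lp.fourierTransformₗᵢ (Space N) ℂ).map_smul c u
    rw [hF]
    filter_upwards [Lp.coeFn_smul c (𝓕 u)] with ξ h1
    simp only [formDensity, h1, Pi.smul_apply, smul_eq_mul]
    rw [mul_assoc c, ← mul_sub, norm_mul, norm_mul]
    ring
  · rw [norm_mul]
    ring

/-- If `β_α(ω) = 0` then `G_ω` attains the lower bound `-ω` of the form. -/
theorem exists_ground_state {N : ℕ} (hN : N = 2 ∨ N = 3) {α ω : ℝ} (hω : 0 < ω)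
    (hβ : betaCoeff N α ω = 0) :
    ∃ G : L2 N, MemEnergySpace G ∧ ‖G‖ = 1 ∧ (pointForm α G G).re = -ω := by
  obtain ⟨G, hG, hFG⟩ := exists_greenL2 hN hω
  have hd : IsDecomp ω G 0 1 := by
    refine ⟨memH1_zero N, ?_⟩
    filter_upwards [hG, Lp.coeFn_zero ℂ 2 (volume : Measure (Space N))] with x h1 h2
    rw [h1, h2]
    simp
  have hG0 : ‖G‖ ≠ 0 := by
    rw [norm_ne_zero_iff]
    rintro rfl
    have hF0 : (𝓕 (0 : L2 N) : L2 N) = 0 := (Lp.fourierTransformₗᵢ (Space N) ℂ).map_zero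
    rw [hF0] at hFG
    have hfalse : ∀ᵐ _ : Space N, False := by
      filter_upwards [hFG, Lp.coeFn_zero ℂ 2 (volume : Measure (Space N))] with ξ h1 h2
      rw [h1] at h2
      exact (symb_pos hω ξ).ne' (by simpa using h2)
    simp only [Filter.eventually_false_iff_eq_bot, ae_eq_bot] at hfalse
    exact NeZero.ne (volume : Measure (Space N)) hfalse
  have hE : MemEnergySpace G := ⟨ω, 0, 1, hω, hd⟩
  have hform : (pointForm α G G).re = -ω * ‖G‖ ^ 2 := by
    rw [hd.pointForm_eq hN α hω, Complex.ofReal_re, hβ, zero_mul, add_zero,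
      ← Lp.norm_fourier_eq, L2.norm_sq_eq_integral, ← integral_const_mul]
    refine integral_congr_ae ?_
    filter_upwards [hFG] with ξ h1
    simp [formDensity, h1]
  refine ⟨((‖G‖⁻¹ : ℝ) : ℂ) • G, hE.smul _, ?_, ?_⟩
  · rw [norm_smul, Complex.norm_real, norm_of_nonneg (by positivity), inv_mul_cancel₀ hG0]
  · rw [pointForm_smul hN α hE, hform, Complex.norm_real, norm_of_nonneg (by positivity)]
    field_simp

theorem exists_betaCoeff_eq_zero {N : ℕ} {α : ℝ} (h : N = 2 ∨ (N = 3 ∧ α < 0)) :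
    ∃ ω : ℝ, 0 < ω ∧ betaCoeff N α ω = 0 := by
  rcases h with rfl | ⟨rfl, hα⟩
  · refine ⟨exp (log 2 - Real.eulerMascheroniConstant - 2 * π * α) ^ 2, by positivity, ?_⟩
    simp only [betaCoeff, if_true]
    rw [sqrt_sq (exp_pos _).le, log_exp]
    field_simp
    ring
  · have : 0 < -α := by linarith
    refine ⟨(4 * π * -α) ^ 2, by positivity, ?_⟩
    rw [betaCoeff, if_neg (by norm_num), if_pos rfl, sqrt_sq (by positivity)]
    field_simp
    ring

/-! ### Scaling of the energy and trial functions -/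

theorem integral_norm_rpow_smul {N : ℕ} (p : ℝ) (u : L2 N) (c : ℂ) :
    ∫ x, ‖(c • u) x‖ ^ p = ‖c‖ ^ p * ∫ x, ‖u x‖ ^ p := by
  rw [← integral_const_mul]
  refine integral_congr_ae ?_
  filter_upwards [Lp.coeFn_smul c u] with x h1
  rw [h1, Pi.smul_apply, smul_eq_mul, norm_mul, mul_rpow (norm_nonneg _) (norm_nonneg _)]

theorem energy_sqrt_smul {N : ℕ} (hN : N = 2 ∨ N = 3) (α p : ℝ) {u : L2 N}
    (hu : MemEnergySpace u) {t : ℝ} (ht : 0 ≤ t) :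
    energy α p ((√t : ℂ) • u) = t * (1 / 2 * (pointForm α u u).re) +
      t ^ (p / 2) * (1 / p * ∫ x, ‖u x‖ ^ p) := by
  have h : (√t) ^ p = t ^ (p / 2) := by
    rw [sqrt_eq_rpow, ← rpow_mul ht]
    ring_nf
  rw [energy, pointForm_smul hN α hu, integral_norm_rpow_smul, Complex.norm_real,
    norm_of_nonneg (sqrt_nonneg t), sq_sqrt ht, h]
  ring

theorem sqrt_smul_mem_massSphere {N : ℕ} {μ t : ℝ} {u : L2 N} (hu : u ∈ massSphere N μ)
    (ht : 0 ≤ t) : (√t : ℂ) • u ∈ massSphere N (t * μ) := by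
  refine ⟨hu.1.smul _, ?_⟩
  rw [norm_smul, Complex.norm_real, norm_of_nonneg (sqrt_nonneg t), mul_pow, sq_sqrt ht, hu.2]

theorem integral_norm_rpow_nonneg {N : ℕ} (p : ℝ) (u : L2 N) : 0 ≤ ∫ x, ‖u x‖ ^ p :=
  integral_nonneg fun _ => by positivity

theorem bddBelow_energy {N : ℕ} (hN : N = 2 ∨ N = 3) {α p ω : ℝ} (hp : 0 < p) (hω : 0 < ω)
    (hβ : betaCoeff N α ω = 0) (μ : ℝ) : BddBelow (energy α p '' massSphere N μ) := by
  refine ⟨-ω * μ / 2, ?_⟩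
  rintro _ ⟨v, hv, rfl⟩
  have h1 := pointForm_re_ge hN hω hβ hv.1
  rw [hv.2] at h1
  have h2 : 0 ≤ 1 / p * ∫ x, ‖v x‖ ^ p :=
    mul_nonneg (by positivity) (integral_norm_rpow_nonneg p v)
  rw [energy]
  linarith

/-- The multiple of `G_ω` of mass `μ` as a trial function: the negative part of its energy is
linear in `μ`, while the nonlinear term is of higher order `μ^{p/2}`. -/
theorem exists_groundEnergy_le {N : ℕ} (hN : N = 2 ∨ N = 3) {α p ω : ℝ} (hp : 0 < p) (hω : 0 < ω)
    (hβ : betaCoeff N α ω = 0) :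
    ∃ C : ℝ, 0 ≤ C ∧ ∀ μ : ℝ, 0 < μ → (massSphere N μ).Nonempty ∧
      groundEnergy N α p μ ≤ -ω * μ / 2 + C * μ ^ (p / 2) := by
  obtain ⟨G, hG, hG1, hGf⟩ := exists_ground_state hN hω hβ
  refine ⟨1 / p * ∫ x, ‖G x‖ ^ p,
    mul_nonneg (by positivity) (integral_norm_rpow_nonneg p G), fun μ hμ => ?_⟩
  have hmem : (√μ : ℂ) • G ∈ massSphere N μ := by
    have := sqrt_smul_mem_massSphere (μ := 1) (u := G) ⟨hG, by rw [hG1, one_pow]⟩ hμ.le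
    rwa [mul_one] at this
  refine ⟨⟨_, hmem⟩, (csInf_le (bddBelow_energy hN hp hω hβ μ) ⟨_, hmem, rfl⟩).trans
    (le_of_eq ?_)⟩
  rw [energy_sqrt_smul hN α p hG hμ.le, hGf]
  ring

/-- The tangent line inequality for `x ↦ x^{s+1}` at the larger endpoint `y`. -/
theorem mul_rpow_sub_le {s x y : ℝ} (hs : 0 < s) (hx : 0 < x) (hxy : x < y) :
    y * y ^ s - x * x ^ s ≤ (s + 1) * y ^ s * (y - x) := by
  have hy : 0 < y := hx.trans hxy
  have h := one_add_mul_self_le_rpow_one_add (s := x / y - 1) (p := s + 1)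
    (by have : 0 < x / y := by positivity
        linarith) (by linarith)
  rw [add_sub_cancel, rpow_add (by positivity), rpow_one, div_rpow hx.le hy.le] at h
  have hys : 0 < y ^ s := rpow_pos_of_pos hy s
  have h' := mul_le_mul_of_nonneg_right h (mul_pos hy hys).le
  have e1 : (1 + (s + 1) * (x / y - 1)) * (y * y ^ s) =
      y * y ^ s + (s + 1) * (y ^ s * (x - y)) := by field_simp
  have e2 : x ^ s / y ^ s * (x / y) * (y * y ^ s) = x * x ^ s := by field_simp
  rw [e1, e2] at h'
  linarith

end PointNLS

end

theorem lemma1p2 (N : ℕ) (α p : ℝ)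
    (h : (N = 2 ∧ 2 < p) ∨ (N = 3 ∧ α < 0 ∧ 2 < p ∧ p < 3)) :
    ∃ μ₀ : ℝ, 0 < μ₀ ∧
      (∀ μ ∈ Set.Ioo (0 : ℝ) μ₀, PointNLS.groundEnergy N α p μ < 0) ∧
      StrictAntiOn (PointNLS.groundEnergy N α p) (Set.Ioo (0 : ℝ) μ₀) := by
  have hN : N = 2 ∨ N = 3 := by tauto
  have hp : 2 < p := by tauto
  obtain ⟨ω, hω, hβ⟩ := PointNLS.exists_betaCoeff_eq_zero (N := N) (α := α) (by tauto)
  obtain ⟨C, hC, hE⟩ := PointNLS.exists_groundEnergy_le hN (p := p) (by linarith) hω hβ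
  set s : ℝ := p / 2 - 1 with hs_def
  have hs : 0 < s := by rw [hs_def]; linarith
  have hps : p / 2 = s + 1 := by rw [hs_def]; ring
  have hpow : ∀ x : ℝ, 0 < x → x ^ (p / 2) = x * x ^ s := fun x hx => by
    rw [hps, Real.rpow_add hx, Real.rpow_one, mul_comm]
  set D : ℝ := C * (s + 2) with hD
  have hD0 : 0 ≤ D := by positivity
  -- `μ₀` is chosen so that `D * μ₀ ^ s ≤ ω / 4`
  set b : ℝ := ω / (4 * (D + 1)) with hb
  have hb0 : 0 < b := by positivity
  have hDb : D * b ≤ ω / 4 := by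
    rw [hb, mul_div_assoc', div_le_div_iff₀ (by positivity) (by norm_num)]
    nlinarith
  have hCb : C * b ≤ D * b := by
    gcongr
    nlinarith
  set μ₀ : ℝ := b ^ (1 / s) with hμ₀
  have hμ₀s : ∀ x : ℝ, 0 < x → x < μ₀ → x ^ s ≤ b := fun x hx hxμ => by
    have : b = μ₀ ^ s := by
      rw [hμ₀, ← Real.rpow_mul hb0.le, one_div_mul_cancel hs.ne', Real.rpow_one]
    rw [this]
    exact Real.rpow_le_rpow hx.le hxμ.le hs.le
  refine ⟨μ₀, Real.rpow_pos_of_pos hb0 _, ?_, ?_⟩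
  · rintro μ ⟨hμ, hμ'⟩
    have h1 := (hE μ hμ).2
    rw [hpow μ hμ] at h1
    have h2 : C * (μ * μ ^ s) ≤ μ * (ω / 4) := by
      calc C * (μ * μ ^ s) = μ * (C * μ ^ s) := by ring
        _ ≤ μ * (C * b) := by gcongr; exact hμ₀s μ hμ hμ'
        _ ≤ _ := by gcongr; linarith
    nlinarith
  · rintro x ⟨hx, hxμ⟩ y ⟨hy, hyμ⟩ hxy
    set t : ℝ := y / x with ht
    have ht1 : 1 < t := (one_lt_div hx).2 hxy
    have htx : t * x = y := by rw [ht]; field_simp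
    set T : ℝ := t ^ (p / 2) with hT
    have hT1 : 1 < T := Real.one_lt_rpow ht1 (by linarith)
    have hTx : T * (x * x ^ s) = y * y ^ s := by
      rw [hT, ← hpow x hx, ← hpow y hy, ← Real.mul_rpow (by linarith) hx.le, htx]
    set ε : ℝ := (y - x) * ω / (4 * (t + T)) with hε
    have hyx : 0 < y - x := by linarith
    have hε0 : 0 < ε := by positivity
    have hεT : ε * (t + T) = (y - x) * ω / 4 := by
      rw [hε]; field_simp
    obtain ⟨hne, hEx⟩ := hE x hx
    obtain ⟨_, ⟨u, hu, rfl⟩, hlt⟩ := exists_lt_of_csInf_lt (hne.image (PointNLS.energy α p))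
      (show sInf _ < PointNLS.groundEnergy N α p x + ε from lt_add_of_pos_right _ hε0)
    have hEy : PointNLS.groundEnergy N α p y ≤ _ :=
      csInf_le (PointNLS.bddBelow_energy hN (by linarith) hω hβ y)
        ⟨_, htx ▸ PointNLS.sqrt_smul_mem_massSphere hu (by linarith : (0 : ℝ) ≤ t), rfl⟩
    rw [PointNLS.energy_sqrt_smul hN α p hu.1 (by linarith), ← hT] at hEy
    have hform := PointNLS.pointForm_re_ge hN hω hβ hu.1
    rw [hu.2] at hform
    have hP : 0 ≤ 1 / p * ∫ x, ‖u x‖ ^ p :=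
      mul_nonneg (by positivity) (PointNLS.integral_norm_rpow_nonneg p u)
    rw [PointNLS.energy] at hlt
    rw [hpow x hx] at hEx
    set A : ℝ := 1 / 2 * (PointNLS.pointForm α u u).re with hA
    set B : ℝ := 1 / p * ∫ x, ‖u x‖ ^ p with hB
    -- the nonlinear part of a near minimiser is small, since its form is at least `-ω x`
    have hB' : B ≤ C * (x * x ^ s) + ε := by linarith
    have hA' : A ≤ -ω * x / 2 + C * (x * x ^ s) + ε := by linarith
    have h1 : (t - 1) * A ≤ (t - 1) * (-ω * x / 2 + C * (x * x ^ s) + ε) :=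
      mul_le_mul_of_nonneg_left hA' (by linarith)
    have h2 : (T - 1) * B ≤ (T - 1) * (C * (x * x ^ s) + ε) :=
      mul_le_mul_of_nonneg_left hB' (by linarith)
    have h3 : (t - 1) * (-ω * x / 2 + C * (x * x ^ s) + ε) =
        (y - x) * (-ω / 2 + C * x ^ s) + (t - 1) * ε := by
      rw [← htx]; ring
    have h4 : (T - 1) * (C * (x * x ^ s) + ε) = C * (y * y ^ s - x * x ^ s) + (T - 1) * ε := by
      rw [← hTx]; ring
    have h5 : C * (y * y ^ s - x * x ^ s) ≤ (y - x) * (C * (s + 1) * b) := by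
      calc C * (y * y ^ s - x * x ^ s) ≤ C * ((s + 1) * y ^ s * (y - x)) :=
            mul_le_mul_of_nonneg_left (PointNLS.mul_rpow_sub_le hs hx hxy) hC
        _ ≤ C * ((s + 1) * b * (y - x)) := by gcongr; exact hμ₀s y hy hyμ
        _ = _ := by ring
    have h6 : (y - x) * (-ω / 2 + C * x ^ s) ≤ (y - x) * (-ω / 2 + C * b) := by
      gcongr; exact hμ₀s x hx hxμ
    have h7 : (y - x) * (-ω / 2 + C * b) + (y - x) * (C * (s + 1) * b) =
        (y - x) * (D * b) - (y - x) * ω / 2 := by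
      rw [hD]; ring
    have h8 : (y - x) * (D * b) ≤ (y - x) * (ω / 4) := by gcongr
    linarith
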